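/- Let $n\ge 2$ and let $\Omega_n=\{1<2<\cdots<n\}$. Transformations of $\Omega_n$ are composed from left to right. Let $\mathcal{IO}_n$ be the monoid of all order-preserving full transformations of $\Omega_n$ whose image is an interval (convex subset) of $\Omega_n$, and let $\mathcal{IM}_n$ be the monoid of all full transformations of $\Omega_n$ that are order-preserving or order-reversing and whose image is an interval. For $1\le i\le n-1$ let $a_i,b_i\in\mathcal{IO}_n$ be given by $$x a_i=\begin{cases}x & x\le i\\ x-1 & x>i\end{cases}\qquad x b_i=\begin{cases}x+1 & x\le i\\ x & x>i\end{cases}$$ and let $h\in\mathcal{IM}_n$ be given by $xh=n+1-x$. Let $A=\{a_1,\dots,a_{n-1}\}$, $B=\{b_1,\dots,b_{n-1}\}$ and $C=A\cup B\cup\{h\}$; these are used both as alphabets and as sets of transformations. A monoid $M$ is defined by the presentation $\langle X\mid R\rangle$ on generators from $M$ named by $X$ if there is an isomorphism from $X^*/{\sim_R}$ onto $M$ that sends the class of each letter to the generator it names, where $\sim_R$ is the congruence on the free monoid $X^*$ generated by the set $R\subseteq X^*\times X^*$. For a set $R$ of relations over $A\cup B$, let $\overline R$ be the set of relations over $C$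 consisting of $R$ together with - $(N_0)$ $h^2=1$; - $(N_1)$ $ha_i=b_{n-i}h$ for $1\le i\le n-1$; - $(N_2)$ $a_1^{n-1}h=b_{n-1}^{n-1}$. Then the $2n-1$ letters of $C$ name $2n-1$ distinct elements of $\mathcal{IM}_n$, and the following hold. 1. Let $R_0$ be the set consisting of the relations - $a_ia_j=a_{j+1}a_i$ for $1\le i\le j\le n-2$, and $a_ia_{n-1}=a_i$ for $1\le i\le n-1$; - $b_ib_j=b_{j-1}b_i$ for $2\le j\le i\le n-1$, and $b_ib_1=b_i$ for $1\le i\le n-1$; - $a_ib_j=b_ja_i$ for $1\le j<i\le n-1$; - $a_ib_{n-1}=b_i$ and $b_ia_1=a_i$ for $1\le i\le n-1$. Then $\mathcal{IO}_n$ is defined by $\langle A\cup B\mid R_0\rangle$, and $\mathcal{IM}_n$ is defined by the presentation $\langle C\mid\overline{R_0}\rangle$ on $2n-1$ generators and $\frac12(3n^2+n)$ relations. 2. More generally, for every presentation $\langle A\cup B\mid R\rangle$ of $\mathcal{IO}_n$ on the generators $A\cup B$, the monoid $\mathcal{IM}_n$ is defined by $\langle C\mid\overline R\rangle$, and $|\overline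 R|=|R|+n+1$. -/

import Mathlib

namespace IntervalMonoids

/-- The chain `1 < 2 < ⋯ < n`. -/
abbrev Chain (n : ℕ) : Type := Set.Icc 1 n

/-- The index set `{1, …, n - 1}`. -/
abbrev Idx (n : ℕ) : Type := Set.Ico 1 n

/-- The monoid of full transformations of the chain, composed from left to right
(the product of `α` and `β` applies `α` first). -/
abbrev Transf (n : ℕ) : Type := (Function.End (Chain n))ᵐᵒᵖ

/-- The transformation `α` as a function. -/
abbrev toFn {n : ℕ} (α : Transf n) : Chain n → Chain n := α.unop

/-- The function `f` as a transformation. -/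
abbrev ofFn {n : ℕ} (f : Chain n → Chain n) : Transf n := MulOpposite.op f

lemma ordConnected_range_comp {X : Type*} [LinearOrder X] {f g : X → X}
    (hf : (Set.range f).OrdConnected) (hg : (Set.range g).OrdConnected)
    (hm : Monotone g ∨ Antitone g) : (Set.range (g ∘ f)).OrdConnected := by
  constructor
  rintro _ ⟨x, rfl⟩ _ ⟨z, rfl⟩ y ⟨h1, h2⟩
  obtain ⟨w, rfl⟩ := hg.out ⟨f x, rfl⟩ ⟨f z, rfl⟩ ⟨h1, h2⟩
  simp only [Function.comp_apply] at h1 h2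
  have key : ∀ p q, f p ≤ w → w ≤ f q → g w ∈ Set.range (g ∘ f) := by
    intro p q hp hq
    obtain ⟨t, ht⟩ := hf.out ⟨p, rfl⟩ ⟨q, rfl⟩ ⟨hp, hq⟩
    exact ⟨t, by simp [ht]⟩
  rcases le_total (f x) w with hx | hx <;> rcases le_total (f z) w with hz | hz
  · rcases hm with hm | hm
    · exact ⟨z, le_antisymm (hm hz) h2⟩
    · exact ⟨x, le_antisymm h1 (hm hx)⟩
  · exact key x z hx hz
  · exact key z x hz hx
  · rcases hm with hm | hm
    · exact ⟨x, le_antisymm h1 (hm hx)⟩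
    · exact ⟨z, le_antisymm (hm hz) h2⟩

/-- The monoid `IO_n` of all order-preserving full transformations of the chain `1 < ⋯ < n`
whose image is an interval. -/
def OrdInt (n : ℕ) : Submonoid (Transf n) where
  carrier := {α | Monotone (toFn α) ∧ (Set.range (toFn α)).OrdConnected}
  one_mem' := by
    refine ⟨monotone_id, ?_⟩
    change (Set.range (id : Chain n → Chain n)).OrdConnected
    rw [Set.range_id]
    exact Set.ordConnected_univ
  mul_mem' := by
    rintro α β ⟨h1, h2⟩ ⟨h3, h4⟩
    exact ⟨h3.comp h1, ordConnected_range_comp (f := toFn α) (g := toFn β) h2 h4 (Or.inl h3)⟩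

/-- The monoid `IM_n` of all monotone (order-preserving or order-reversing) full transformations
of the chain `1 < ⋯ < n` whose image is an interval. -/
def MonInt (n : ℕ) : Submonoid (Transf n) where
  carrier := {α | (Monotone (toFn α) ∨ Antitone (toFn α)) ∧
    (Set.range (toFn α)).OrdConnected}
  one_mem' := by
    refine ⟨Or.inl monotone_id, ?_⟩
    change (Set.range (id : Chain n → Chain n)).OrdConnected
    rw [Set.range_id]
    exact Set.ordConnected_univ
  mul_mem' := by
    rintro α β ⟨h1, h2⟩ ⟨h3, h4⟩
    refine ⟨?_, ordConnected_range_comp (f := toFn α) (g := toFn β) h2 h4 h3⟩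
    rcases h1 with h1 | h1 <;> rcases h3 with h3 | h3
    · exact Or.inl (h3.comp h1)
    · exact Or.inr (h3.comp_monotone h1)
    · exact Or.inr (h3.comp_antitone h1)
    · exact Or.inl (h3.comp h1)

/-- `a_i` maps `x` to `x` if `x ≤ i` and to `x - 1` if `x > i`. -/
def aFn {n : ℕ} (i : Idx n) (x : Chain n) : Chain n :=
  ⟨if x.1 ≤ i.1 then x.1 else x.1 - 1, by
    have hx := x.2
    have hi := i.2
    simp only [Set.mem_Icc, Set.mem_Ico] at *
    split_ifs <;> omega⟩

/-- `b_i` maps `x` to `x + 1` if `x ≤ i` and to `x` if `x > i`. -/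
def bFn {n : ℕ} (i : Idx n) (x : Chain n) : Chain n :=
  ⟨if x.1 ≤ i.1 then x.1 + 1 else x.1, by
    have hx := x.2
    have hi := i.2
    simp only [Set.mem_Icc, Set.mem_Ico] at *
    split_ifs <;> omega⟩

/-- `h` is the reflection `x ↦ n + 1 - x`. -/
def hFn {n : ℕ} (x : Chain n) : Chain n :=
  ⟨n + 1 - x.1, by
    have hx := x.2
    simp only [Set.mem_Icc] at *
    omega⟩

lemma aFn_val {n : ℕ} (i : Idx n) (x : Chain n) :
    (aFn i x).1 = if x.1 ≤ i.1 then x.1 else x.1 - 1 := rfl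

lemma bFn_val {n : ℕ} (i : Idx n) (x : Chain n) :
    (bFn i x).1 = if x.1 ≤ i.1 then x.1 + 1 else x.1 := rfl

lemma hFn_val {n : ℕ} (x : Chain n) : (hFn x).1 = n + 1 - x.1 := rfl

lemma aFn_monotone {n : ℕ} (i : Idx n) : Monotone (aFn i) := by
  intro x y hxy
  have hxy' : x.1 ≤ y.1 := hxy
  rw [← Subtype.coe_le_coe, aFn_val, aFn_val]
  split_ifs <;> omega

lemma bFn_monotone {n : ℕ} (i : Idx n) : Monotone (bFn i) := by
  intro x y hxy
  have hxy' : x.1 ≤ y.1 := hxy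
  rw [← Subtype.coe_le_coe, bFn_val, bFn_val]
  split_ifs <;> omega

lemma hFn_antitone {n : ℕ} : Antitone (hFn (n := n)) := by
  intro x y hxy
  have hxy' : x.1 ≤ y.1 := hxy
  rw [← Subtype.coe_le_coe, hFn_val, hFn_val]
  omega

lemma aFn_ordConnected {n : ℕ} (i : Idx n) : (Set.range (aFn i)).OrdConnected := by
  constructor
  rintro _ - _ ⟨z, rfl⟩ y ⟨-, h2⟩
  have h2' : y.1 ≤ (aFn i z).1 := h2
  rw [aFn_val] at h2'
  have hi := Set.mem_Ico.1 i.2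
  have hy := Set.mem_Icc.1 y.2
  have hz := Set.mem_Icc.1 z.2
  by_cases h : y.1 ≤ i.1
  · refine ⟨y, Subtype.ext ?_⟩
    rw [aFn_val, if_pos h]
  · have hy1 : y.1 + 1 ≤ n := by
      split_ifs at h2' <;> omega
    refine ⟨⟨y.1 + 1, Set.mem_Icc.2 ⟨by omega, hy1⟩⟩, Subtype.ext ?_⟩
    rw [aFn_val, if_neg (by simp only; omega)]
    simp only
    omega

lemma bFn_ordConnected {n : ℕ} (i : Idx n) : (Set.range (bFn i)).OrdConnected := by
  constructor
  rintro _ ⟨x, rfl⟩ _ - y ⟨h1, -⟩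
  have h1' : (bFn i x).1 ≤ y.1 := h1
  rw [bFn_val] at h1'
  have hi := Set.mem_Ico.1 i.2
  have hy := Set.mem_Icc.1 y.2
  have hx := Set.mem_Icc.1 x.2
  by_cases h : y.1 ≤ i.1
  · have hy1 : 1 ≤ y.1 - 1 := by
      split_ifs at h1' <;> omega
    refine ⟨⟨y.1 - 1, Set.mem_Icc.2 ⟨hy1, by omega⟩⟩, Subtype.ext ?_⟩
    rw [bFn_val, if_pos (by simp only; omega)]
    simp only
    omega
  · refine ⟨y, Subtype.ext ?_⟩
    rw [bFn_val, if_neg h]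

lemma hFn_ordConnected {n : ℕ} : (Set.range (hFn (n := n))).OrdConnected := by
  have hs : Function.Surjective (hFn (n := n)) := by
    intro y
    have hy := Set.mem_Icc.1 y.2
    refine ⟨hFn y, Subtype.ext ?_⟩
    rw [hFn_val, hFn_val]
    omega
  rw [hs.range_eq]
  exact Set.ordConnected_univ

lemma aFn_mem {n : ℕ} (i : Idx n) : ofFn (aFn i) ∈ OrdInt n :=
  ⟨aFn_monotone i, aFn_ordConnected i⟩

lemma bFn_mem {n : ℕ} (i : Idx n) : ofFn (bFn i) ∈ OrdInt n :=
  ⟨bFn_monotone i, bFn_ordConnected i⟩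

lemma hFn_mem (n : ℕ) : ofFn (hFn (n := n)) ∈ MonInt n :=
  ⟨Or.inr hFn_antitone, hFn_ordConnected⟩

lemma ordInt_le_monInt (n : ℕ) : OrdInt n ≤ MonInt n := fun _ h => ⟨Or.inl h.1, h.2⟩

/-- The alphabet `A ∪ B = {a_1, …, a_{n-1}} ∪ {b_1, …, b_{n-1}}`. -/
inductive GenAB (n : ℕ) : Type
  | a (i : Idx n) : GenAB n
  | b (i : Idx n) : GenAB n

/-- The alphabet `C = A ∪ B ∪ {h}`. -/
inductive GenC (n : ℕ) : Type
  | ab (x : GenAB n) : GenC n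
  | h : GenC n

/-- The letters of `A ∪ B` as elements of `OrdInt n`. -/
def evalAB (n : ℕ) : GenAB n → OrdInt n
  | .a i => ⟨ofFn (aFn i), aFn_mem i⟩
  | .b i => ⟨ofFn (bFn i), bFn_mem i⟩

/-- The letters of `C` as elements of `MonInt n`. -/
def evalC (n : ℕ) : GenC n → MonInt n
  | .ab x => ⟨(evalAB n x).1, ordInt_le_monInt n (evalAB n x).2⟩
  | .h => ⟨ofFn hFn, hFn_mem n⟩

/-- A set of relations over the alphabet `α`: a set of pairs of words. -/
abbrev Rels (α : Type) : Type := Set (FreeMonoid α × FreeMonoid α)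

/-- The monoid `M` is defined by the presentation `⟨α ∣ R⟩` on the generators `g x`, `x : α`: the
quotient of the free monoid on `α` by the congruence generated by `R` is isomorphic to `M`, through
an isomorphism that sends the class of each letter `x` to `g x`. -/
def DefinedBy {α M : Type} [Monoid M] (g : α → M) (R : Rels α) : Prop :=
  ∃ e : PresentedMonoid (fun u v => (u, v) ∈ R) ≃* M,
    ∀ x : α, e (PresentedMonoid.of _ x) = g x

/-- The letter `a_i` as a word over `A ∪ B`. -/
abbrev wa {n : ℕ} (i : Idx n) : FreeMonoid (GenAB n) := FreeMonoid.of (GenAB.a i)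

/-- The letter `b_i` as a word over `A ∪ B`. -/
abbrev wb {n : ℕ} (i : Idx n) : FreeMonoid (GenAB n) := FreeMonoid.of (GenAB.b i)

/-- A set `R` of `(3n² - n - 2) / 2` relations over `A ∪ B`:
* `a_i a_j = a_{j+1} a_i` for `1 ≤ i ≤ j ≤ n - 2`, and `a_i a_{n-1} = a_i`;
* `b_i b_j = b_{j-1} b_i` for `2 ≤ j ≤ i ≤ n - 1`, and `b_i b_1 = b_i`;
* `a_i b_j = b_j a_i` for `1 ≤ j < i ≤ n - 1`;
* `a_i b_{n-1} = b_i` and `b_i a_1 = a_i`. -/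
def relsAB (n : ℕ) : Rels (GenAB n) :=
  {p | ∃ i j k : Idx n, i.1 ≤ j.1 ∧ k.1 = j.1 + 1 ∧ p = (wa i * wa j, wa k * wa i)} ∪
  {p | ∃ i j : Idx n, j.1 + 1 = n ∧ p = (wa i * wa j, wa i)} ∪
  {p | ∃ i j k : Idx n, j.1 ≤ i.1 ∧ k.1 + 1 = j.1 ∧ p = (wb i * wb j, wb k * wb i)} ∪
  {p | ∃ i j : Idx n, j.1 = 1 ∧ p = (wb i * wb j, wb i)} ∪
  {p | ∃ i j : Idx n, j.1 < i.1 ∧ p = (wa i * wb j, wb j * wa i)} ∪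
  {p | ∃ i j : Idx n, j.1 + 1 = n ∧ p = (wa i * wb j, wb i)} ∪
  {p | ∃ i j : Idx n, j.1 = 1 ∧ p = (wb i * wa j, wa i)}

/-- A word over `A ∪ B`, read as a word over `C`. -/
abbrev liftWord {n : ℕ} (w : FreeMonoid (GenAB n)) : FreeMonoid (GenC n) :=
  FreeMonoid.map GenC.ab w

/-- The letter `h` as a word over `C`. -/
abbrev wh (n : ℕ) : FreeMonoid (GenC n) := FreeMonoid.of GenC.h

/-- The relation `h² = 1`. -/
def N0 (n : ℕ) : Rels (GenC n) := {(wh n * wh n, 1)}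

/-- The relations `h a_i = b_{n-i} h`, for `1 ≤ i ≤ n - 1`. -/
def N1 (n : ℕ) : Rels (GenC n) :=
  {p | ∃ i j : Idx n, i.1 + j.1 = n ∧ p = (wh n * liftWord (wa i), liftWord (wb j) * wh n)}

/-- The relation `a_1^{n-1} h = b_{n-1}^{n-1}` (a single relation, for `n ≥ 2`). -/
def N2 (n : ℕ) : Rels (GenC n) :=
  {p | ∃ i j : Idx n, i.1 = 1 ∧ j.1 + 1 = n ∧
    p = (liftWord (wa i) ^ (n - 1) * wh n, liftWord (wb j) ^ (n - 1))}

/-- The set of relations `R ∪ N₀ ∪ N₁ ∪ N₂` over `C`, for a set `R` of relations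
over `A ∪ B`. -/
def relsBar {n : ℕ} (R : Rels (GenAB n)) : Rels (GenC n) :=
  Prod.map liftWord liftWord '' R ∪ N0 n ∪ N1 n ∪ N2 n

end IntervalMonoids

/-! For $\mathcal{IO}_n$ the proof is a normal form argument. The relations rewrite every word as
$a_{c_1}\cdots a_{c_m}b_{n-1}^t$ with $c_1>\cdots>c_m$ and $t\le m$
(`SatisfiesRels.exists_normalForm`). As a transformation, the first factor fixes 1, rises by 0 or 1
at each step, and is flat from $x$ to $x+1$ exactly when $x$ is one of the $c_k$; its value at $n$
is $n-m$. The power of $b_{n-1}$ then shifts by $t$, and $t\le m$ means that nothing is cut off at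
$n$. So the image of 1 gives $t$ and the flat steps give the $c_k$: distinct normal forms act
differently. Conversely, an order-preserving map with interval image also rises by 0 or 1 at each
step, so it is reached.

For $\mathcal{IM}_n$ only the fact that $R$ presents $\mathcal{IO}_n$ is used. It yields a
homomorphism $\iota$ from $\mathcal{IO}_n$ to the monoid presented by $\overline R$, and evaluation
after $\iota$ is the inclusion. By $N_0$ and $N_1$ every element is $\iota u$ or $\iota u\cdot h$.
Two such forms of different type can have equal values only if the map is both order-preserving and
order-reversing, hence constant. The single relation $N_2$, moved along by $N_1$, removes $h$ from
every constant, and injectivity follows.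

The relations are counted through their left-hand sides: these separate the explicit relations from
each other, and $R$, $N_0$, $N_1$, $N_2$ from one another. -/

namespace IntervalMonoids

/-! ### Rewriting to normal form in an abstract monoid -/

section NormalForm

variable {M : Type*} [Monoid M]

/-- Families `α`, `β` satisfying the relations of `relsAB n`, extended by `α n = 1` and `β 0 = 1`. -/
structure SatisfiesRels (n : ℕ) (α β : ℕ → M) : Prop where
  a_a : ∀ i j, 1 ≤ i → i ≤ j → j < n → α i * α j = α (j + 1) * α i
  a_top : α n = 1
  b_b : ∀ i j, 1 ≤ j → j ≤ i → i < n → β i * β j = β (j - 1) * β i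
  b_zero : β 0 = 1
  a_b : ∀ i j, 1 ≤ j → j < i → i < n → α i * β j = β j * α i
  a_b_last : ∀ i, 1 ≤ i → i < n → α i * β (n - 1) = β i
  b_a_one : ∀ i, 1 ≤ i → i < n → β i * α 1 = α i

/-- Strictly increasing lists of elements of `{1, …, n - 1}`. -/
def IsIndexList (n : ℕ) (L : List ℕ) : Prop := L.Pairwise (· < ·) ∧ ∀ c ∈ L, 1 ≤ c ∧ c < n

lemma isIndexList_nil (n : ℕ) : IsIndexList n [] := ⟨List.Pairwise.nil, by simp⟩

lemma isIndexList_cons {n c : ℕ} {L : List ℕ} :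
    IsIndexList n (c :: L) ↔ (1 ≤ c ∧ c < n) ∧ (∀ d ∈ L, c < d) ∧ IsIndexList n L := by
  simp only [IsIndexList, List.pairwise_cons, List.forall_mem_cons]
  tauto

lemma isIndexList_concat {n c : ℕ} {L : List ℕ} :
    IsIndexList n (L ++ [c]) ↔ (1 ≤ c ∧ c < n) ∧ (∀ d ∈ L, d < c) ∧ IsIndexList n L := by
  simp only [IsIndexList, List.pairwise_append, List.forall_mem_append, List.mem_singleton,
    List.pairwise_singleton, forall_eq]
  tauto

/-- The product of the `α c`, `c ∈ L`, in reverse order. -/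
def prodRev (α : ℕ → M) (L : List ℕ) : M := (L.map α).reverse.prod

@[simp] lemma prodRev_nil (α : ℕ → M) : prodRev α [] = 1 := rfl

@[simp] lemma prodRev_cons (α : ℕ → M) (c : ℕ) (L : List ℕ) :
    prodRev α (c :: L) = prodRev α L * α c := by simp [prodRev]

namespace SatisfiesRels

variable {n : ℕ} {α β : ℕ → M}

/-- Insertion: `α j` moves left past each `α c` with `c ≤ j`, its index growing by one each time,
until it meets a larger index or becomes `α n = 1`. The last clause keeps lower bounds, so that the
factors passed over can be put back at the head of the list. -/
lemma exists_prodRev_mul (H : SatisfiesRels n α β) {L : List ℕ} (hL : IsIndexList n L) {j : ℕ}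
    (hj : 1 ≤ j) (hjn : j ≤ n) :
    ∃ L', IsIndexList n L' ∧ prodRev α L * α j = prodRev α L' ∧
      ∀ d, (∀ c ∈ L, d < c) → d < j → ∀ c ∈ L', d < c := by
  rcases hjn.eq_or_lt with rfl | hjn
  · exact ⟨L, hL, by rw [H.a_top, mul_one], fun d h _ => h⟩
  induction L generalizing j with
  | nil =>
    exact ⟨[j], isIndexList_cons.2 ⟨⟨hj, hjn⟩, by simp, isIndexList_nil n⟩, by simp, by simp⟩
  | cons c L ih =>
    obtain ⟨hc, hcL, hL'⟩ := isIndexList_cons.1 hL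
    rcases lt_or_ge j c with hjc | hcj
    · refine ⟨j :: c :: L, isIndexList_cons.2 ⟨⟨hj, hjn⟩, ?_, hL⟩, by simp, ?_⟩
      · rw [List.forall_mem_cons]
        exact ⟨hjc, fun d hd => hjc.trans (hcL d hd)⟩
      · intro d h1 h2
        rw [List.forall_mem_cons]
        exact ⟨h2, h1⟩
    · have key : prodRev α (c :: L) * α j = prodRev α L * α (j + 1) * α c := by
        rw [prodRev_cons, mul_assoc, H.a_a c j hc.1 hcj hjn, mul_assoc]
      rw [key]
      rcases (Nat.succ_le_of_lt hjn).eq_or_lt with hjn' | hjn'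
      · refine ⟨c :: L, hL, ?_, fun d h _ => h⟩
        rw [show j + 1 = n from hjn', H.a_top, mul_one, prodRev_cons]
      · obtain ⟨L', h1, h2, h3⟩ := ih hL' (j := j + 1) (by omega) hjn'.le hjn'
        refine ⟨c :: L', isIndexList_cons.2 ⟨hc, h3 c hcL (by omega), h1⟩, ?_, ?_⟩
        · rw [h2, prodRev_cons]
        · intro d hd hdj
          rw [List.forall_mem_cons] at hd ⊢
          exact ⟨hd.1, h3 d hd.2 (by omega)⟩

/-- The mirror image of insertion for the `α`: the index of `β j` drops by one at each exchange, and
the letter may vanish as `β 0 = 1`. -/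
lemma exists_map_prod_mul (H : SatisfiesRels n α β) {L : List ℕ} (hL : IsIndexList n L) {j : ℕ}
    (hjn : j < n) :
    ∃ L', IsIndexList n L' ∧ (L.map β).prod * β j = (L'.map β).prod ∧
      ∀ d, (∀ c ∈ L, c < d) → j < d → ∀ c ∈ L', c < d := by
  induction L using List.reverseRecOn generalizing j with
  | nil =>
    rcases j.eq_zero_or_pos with rfl | hj
    · exact ⟨[], isIndexList_nil n, by simp [H.b_zero], by simp⟩
    · exact ⟨[j], isIndexList_cons.2 ⟨⟨hj, hjn⟩, by simp, isIndexList_nil n⟩, by simp, by simp⟩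
  | append_singleton L c ih =>
    rcases j.eq_zero_or_pos with rfl | hj
    · exact ⟨_, hL, by rw [H.b_zero, mul_one], fun d h _ => h⟩
    obtain ⟨hc, hcL, hL'⟩ := isIndexList_concat.1 hL
    rcases lt_or_ge c j with hcj | hjc
    · refine ⟨(L ++ [c]) ++ [j], isIndexList_concat.2 ⟨⟨hj, hjn⟩, ?_, hL⟩, by simp [mul_assoc], ?_⟩
      · simp only [List.forall_mem_append, List.mem_singleton, forall_eq]
        exact ⟨fun d hd => (hcL d hd).trans hcj, hcj⟩
      · intro d h1 h2
        rw [List.forall_mem_append]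
        exact ⟨h1, by simpa using h2⟩
    · obtain ⟨L', h1, h2, h3⟩ := ih hL' (j := j - 1) (by omega)
      refine ⟨L' ++ [c], isIndexList_concat.2 ⟨hc, h3 c hcL (by omega), h1⟩, ?_, ?_⟩
      · simp only [List.map_append, List.prod_append, List.map_cons, List.map_nil,
          List.prod_singleton]
        rw [mul_assoc, H.b_b c j hj hjc hc.2, ← mul_assoc, h2]
      · intro d hd hdj
        rw [List.forall_mem_append] at hd ⊢
        exact ⟨h3 d hd.1 (by omega), hd.2⟩

/-- Both sides equal `β (n - 1) * β i * α 1`: on the right, `α (i - 1) * β (n - 1)` is `β (i - 1)`,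
which commutes with `α (n - 1) = β (n - 1) * α 1`. -/
lemma b_last_mul_a (H : SatisfiesRels n α β) {i : ℕ} (hi : 2 ≤ i) (hin : i < n) :
    β (n - 1) * α i = α (n - 1) * α (i - 1) * β (n - 1) := by
  rw [mul_assoc, H.a_b_last (i - 1) (by omega) (by omega),
    H.a_b (n - 1) (i - 1) (by omega) (by omega) (by omega),
    ← H.b_a_one (n - 1) (by omega) (by omega), ← mul_assoc,
    ← H.b_b (n - 1) i (by omega) (by omega) (by omega), mul_assoc,
    H.b_a_one i (by omega) hin]

lemma exists_mul_a (H : SatisfiesRels n α β) (t : ℕ) {L : List ℕ} (hL : IsIndexList n L) {i : ℕ}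
    (hi : 1 ≤ i) (hin : i < n) :
    ∃ L' t', IsIndexList n L' ∧ t' ≤ t ∧
      prodRev α L * β (n - 1) ^ t * α i = prodRev α L' * β (n - 1) ^ t' := by
  -- Passing one `β (n - 1)` replaces `α i` by `α (n - 1)`, or by `α (n - 1) * α (i - 1)` with the
  -- `β` restored. The second factor then meets an exponent that may already have dropped, whence
  -- strong induction and the bound `t' ≤ t`.
  induction t using Nat.strong_induction_on generalizing L i with
  | _ t ih =>
    cases t with
    | zero =>
      obtain ⟨L', h1, h2, -⟩ := H.exists_prodRev_mul hL hi hin.le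
      exact ⟨L', 0, h1, le_rfl, by simpa using h2⟩
    | succ t =>
      obtain ⟨L₁, t₁, hL₁, ht₁, e₁⟩ := ih t (by omega) hL (i := n - 1) (by omega) (by omega)
      rcases hi.eq_or_lt with rfl | hi
      · refine ⟨L₁, t₁, hL₁, by omega, ?_⟩
        rw [pow_succ, mul_assoc, mul_assoc, H.b_a_one (n - 1) (by omega) (by omega), ← mul_assoc,
          e₁]
      · obtain ⟨L₂, t₂, hL₂, ht₂, e₂⟩ :=
          ih t₁ (by omega) hL₁ (i := i - 1) (by omega) (by omega)
        refine ⟨L₂, t₂ + 1, hL₂, by omega, ?_⟩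
        rw [pow_succ, mul_assoc, mul_assoc, H.b_last_mul_a hi hin, mul_assoc, ← mul_assoc,
          ← mul_assoc, e₁, ← mul_assoc, e₂, pow_succ, mul_assoc]

lemma prodRev_mul_b (H : SatisfiesRels n α β) {L : List ℕ} (hL : IsIndexList n L) {j : ℕ}
    (hj : 1 ≤ j) (hjL : ∀ c ∈ L, j < c) : prodRev α L * β j = β j * prodRev α L := by
  induction L with
  | nil => simp
  | cons c L ih =>
    obtain ⟨hc, -, hL'⟩ := isIndexList_cons.1 hL
    rw [List.forall_mem_cons] at hjL
    rw [prodRev_cons, mul_assoc, H.a_b c j hj hjL.1 hc.2, ← mul_assoc, ih hL' hjL.2, mul_assoc]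

/-- Each `α c` absorbs one `β (n - 1)` to become `β c`, which commutes to the front past the `α` of
larger index. This is the boundary case `t = L.length`, where the normal form is a product of `β`
alone. -/
lemma prodRev_mul_pow_length (H : SatisfiesRels n α β) {L : List ℕ} (hL : IsIndexList n L) :
    prodRev α L * β (n - 1) ^ L.length = (L.map β).prod := by
  induction L with
  | nil => simp
  | cons c L ih =>
    obtain ⟨hc, hcL, hL'⟩ := isIndexList_cons.1 hL
    rw [prodRev_cons, List.length_cons, pow_succ', mul_assoc, ← mul_assoc (α c),
      H.a_b_last c hc.1 hc.2, ← mul_assoc, H.prodRev_mul_b hL' hc.1 hcL, mul_assoc, ih hL',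
      List.map_cons, List.prod_cons]

lemma exists_reduced (H : SatisfiesRels n α β) (hn : 2 ≤ n) (t : ℕ) {L : List ℕ}
    (hL : IsIndexList n L) :
    ∃ L' t', IsIndexList n L' ∧ t' ≤ L'.length ∧
      prodRev α L * β (n - 1) ^ t = prodRev α L' * β (n - 1) ^ t' := by
  induction t with
  | zero => exact ⟨L, 0, hL, Nat.zero_le _, rfl⟩
  | succ t ih =>
    obtain ⟨L₁, t₁, hL₁, ht₁, e⟩ := ih
    rw [pow_succ, ← mul_assoc, e]
    rcases ht₁.eq_or_lt with rfl | ht₁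
    -- The exponent is maximal, so the element is a pure product of `β`; the extra letter is
    -- inserted there and the result converted back.
    · obtain ⟨L₂, hL₂, e₂, -⟩ := H.exists_map_prod_mul hL₁ (j := n - 1) (by omega)
      exact ⟨L₂, L₂.length, hL₂, le_rfl, by
        rw [H.prodRev_mul_pow_length hL₁, e₂, H.prodRev_mul_pow_length hL₂]⟩
    · exact ⟨L₁, t₁ + 1, hL₁, ht₁, by rw [pow_succ, mul_assoc]⟩

/-- Every product of the `α i` and `β i` has the normal form `α c₁ ⋯ α cₘ * β (n - 1) ^ t` with
`c₁ > ⋯ > cₘ` and `t ≤ m`. -/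
lemma exists_normalForm (H : SatisfiesRels n α β) (hn : 2 ≤ n) {s : Set M}
    (hs : ∀ y ∈ s, ∃ i, 1 ≤ i ∧ i < n ∧ (y = α i ∨ y = β i)) {x : M}
    (hx : x ∈ Submonoid.closure s) :
    ∃ L t, IsIndexList n L ∧ t ≤ L.length ∧ x = prodRev α L * β (n - 1) ^ t := by
  suffices h : ∃ L t, IsIndexList n L ∧ x = prodRev α L * β (n - 1) ^ t by
    obtain ⟨L, t, hL, rfl⟩ := h
    exact H.exists_reduced hn t hL
  induction hx using Submonoid.closure_induction_right with
  | one => exact ⟨[], 0, isIndexList_nil n, by simp⟩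
  | mul_right x _ y hy ih =>
    obtain ⟨L, t, hL, rfl⟩ := ih
    obtain ⟨i, hi, hin, rfl | rfl⟩ := hs y hy
    · obtain ⟨L', t', hL', -, e⟩ := H.exists_mul_a t hL hi hin
      exact ⟨L', t', hL', e⟩
    · obtain ⟨L', t', hL', -, e⟩ := H.exists_mul_a t hL hi hin
      refine ⟨L', t' + 1, hL', ?_⟩
      -- Writing `β i` as `α i * β (n - 1)` reduces this letter to the case of `α i`.
      rw [← H.a_b_last i hi hin, ← mul_assoc, e, pow_succ, mul_assoc]

end SatisfiesRels

end NormalForm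

/-! ### Collapsing maps on the natural numbers -/

/-- The transformation `a_{c₁} ⋯ a_{cₘ}` with `c₁ > ⋯ > cₘ` the entries of the list, as a function
on natural numbers. -/
def collapse : List ℕ → ℕ → ℕ
  | [], x => x
  | c :: L, x => if collapse L x ≤ c then collapse L x else collapse L x - 1

lemma collapse_cons (c : ℕ) (L : List ℕ) (x : ℕ) :
    collapse (c :: L) x = if collapse L x ≤ c then collapse L x else collapse L x - 1 := rfl

lemma collapse_of_le {L : List ℕ} {x : ℕ} (h : ∀ c ∈ L, x ≤ c) : collapse L x = x := by
  induction L with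
  | nil => rfl
  | cons c L ih =>
    rw [List.forall_mem_cons] at h
    rw [collapse_cons, ih h.2, if_pos h.1]

/-- The entries after the head `c` exceed `c`, so their collapse fixes everything up to `c + 1`. The
head therefore adds a flat step exactly at `c` and lowers later values uniformly. -/
lemma collapse_succ {L : List ℕ} (hL : L.Pairwise (· < ·)) (x : ℕ) :
    collapse L (x + 1) = if x ∈ L then collapse L x else collapse L x + 1 := by
  induction L generalizing x with
  | nil => simp [collapse]
  | cons c L ih =>
    rw [List.pairwise_cons] at hL
    have hm : Monotone (collapse L) := monotone_nat_of_le_succ fun y => by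
      rw [ih hL.2 y]
      split_ifs <;> omega
    have hc : collapse L (c + 1) = c + 1 := collapse_of_le fun d hd => hL.1 d hd
    rcases lt_trichotomy x c with h | rfl | h
    · have h1 : x ∉ c :: L := by
        intro h'
        rcases List.mem_cons.1 h' with h' | h'
        · omega
        · have := hL.1 x h'
          omega
      have h2 : ∀ d ∈ c :: L, x + 1 ≤ d := by
        rw [List.forall_mem_cons]
        exact ⟨h, fun d hd => by have := hL.1 d hd; omega⟩
      rw [if_neg h1, collapse_of_le h2, collapse_of_le fun d hd => (Nat.le_succ x).trans (h2 d hd)]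
    · have hx : collapse L x = x := collapse_of_le fun d hd => (hL.1 d hd).le
      simp [collapse_cons, hc, hx]
    · have h1 := hm h
      rw [Nat.succ_eq_add_one, hc] at h1
      have h2 := hm (Nat.le_succ x)
      rw [Nat.succ_eq_add_one] at h2
      have h3 : ¬ collapse L x ≤ c := by omega
      have h4 : ¬ collapse L (x + 1) ≤ c := by omega
      rw [collapse_cons, collapse_cons, if_neg h3, if_neg h4, ih hL.2 x]
      simp only [List.mem_cons, h.ne', false_or]
      split_ifs <;> omega

lemma collapse_monotone {L : List ℕ} (hL : L.Pairwise (· < ·)) : Monotone (collapse L) :=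
  monotone_nat_of_le_succ fun x => by
    rw [collapse_succ hL x]
    split_ifs <;> omega

lemma collapse_add_length {L : List ℕ} (hL : L.Pairwise (· < ·)) {n : ℕ} (h : ∀ c ∈ L, c < n) :
    collapse L n + L.length = n := by
  induction L with
  | nil => rfl
  | cons c L ih =>
    rw [List.pairwise_cons] at hL
    rw [List.forall_mem_cons] at h
    have h1 := collapse_monotone hL.2 (Nat.succ_le_of_lt h.1)
    rw [Nat.succ_eq_add_one, collapse_of_le fun d hd => hL.1 d hd] at h1
    have h2 := ih hL.2 h.2
    rw [collapse_cons, if_neg (by omega), List.length_cons]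
    omega

/-- The values of `collapse L` on `{1, …, n}`, shifted by `t`, determine `L` and `t`. -/
lemma collapse_add_injective {n : ℕ} (hn : 2 ≤ n) {L L' : List ℕ} (hL : IsIndexList n L)
    (hL' : IsIndexList n L') {t t' : ℕ}
    (h : ∀ x, 1 ≤ x → x ≤ n → collapse L x + t = collapse L' x + t') : L = L' ∧ t = t' := by
  have ht := h 1 le_rfl (by omega)
  rw [collapse_of_le fun c hc => (hL.2 c hc).1, collapse_of_le fun c hc => (hL'.2 c hc).1] at ht
  refine ⟨hL.1.eq_of_mem_iff hL'.1 fun c => ?_, by omega⟩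
  by_cases hc : 1 ≤ c ∧ c < n
  · have h1 := h c hc.1 hc.2.le
    have h2 := h (c + 1) (by omega) (by omega)
    rw [collapse_succ hL.1, collapse_succ hL'.1] at h2
    split_ifs at h2 <;> first | omega | tauto
  · exact ⟨fun h' => absurd (hL.2 c h') hc, fun h' => absurd (hL'.2 c h') hc⟩

/-! ### Presented monoids and indexed families -/

section Presentations

variable {α M : Type} [Monoid M]

lemma definedBy_of_bijective {g : α → M} {R : Rels α}
    (h : ∀ u v, (u, v) ∈ R → FreeMonoid.lift g u = FreeMonoid.lift g v)
    (hb : Function.Bijective (PresentedMonoid.lift (rels := fun u v => (u, v) ∈ R) g h)) :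
    DefinedBy g R :=
  ⟨MulEquiv.ofBijective _ hb, fun _ => rfl⟩

lemma lift_presentedMonoid_of (r : FreeMonoid α → FreeMonoid α → Prop) (w : FreeMonoid α) :
    FreeMonoid.lift (PresentedMonoid.of r) w = PresentedMonoid.mk r w := by
  have : FreeMonoid.lift (PresentedMonoid.of r) = PresentedMonoid.mk r :=
    FreeMonoid.hom_eq fun x => by rw [FreeMonoid.lift_eval_of]; rfl
  rw [this]

/-- The family `g`, extended to all natural numbers by `1`. -/
def extendOne {n : ℕ} (g : Idx n → M) (k : ℕ) : M :=
  if h : k ∈ Set.Ico 1 n then g ⟨k, h⟩ else 1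

lemma extendOne_of_mem {n : ℕ} (g : Idx n → M) {k : ℕ} (h : k ∈ Set.Ico 1 n) :
    extendOne g k = g ⟨k, h⟩ := dif_pos h

lemma extendOne_of_notMem {n : ℕ} (g : Idx n → M) {k : ℕ} (h : k ∉ Set.Ico 1 n) :
    extendOne g k = 1 := dif_neg h

lemma satisfiesRels_extendOne {n : ℕ} (f : GenAB n → M)
    (hf : ∀ u v, (u, v) ∈ relsAB n → FreeMonoid.lift f u = FreeMonoid.lift f v) :
    SatisfiesRels n (extendOne fun i => f (.a i)) (extendOne fun i => f (.b i)) where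
  a_a i j hi hij hj := by
    rw [extendOne_of_mem _ (k := i) ⟨hi, by omega⟩, extendOne_of_mem _ (k := j) ⟨by omega, hj⟩]
    rcases (Nat.succ_le_of_lt hj).eq_or_lt with h | h
    -- Here `j + 1 = n`, and the value 1 at `n` makes this the relation $a_ia_{n-1}=a_i$. The value
    -- 1 at 0 does the same for $b_ib_1=b_i$ below.
    · rw [extendOne_of_notMem _ (by simp only [Set.mem_Ico]; omega), one_mul]
      have := hf (wa ⟨i, hi, by omega⟩ * wa ⟨j, by omega, hj⟩) (wa ⟨i, hi, by omega⟩)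
        (by simp only [relsAB, Set.mem_union]
            exact Or.inl <| Or.inl <| Or.inl <| Or.inl <| Or.inl <| Or.inr ⟨_, _, h, rfl⟩)
      simpa using this
    · rw [extendOne_of_mem _ (k := j + 1) ⟨by omega, h⟩]
      have := hf (wa ⟨i, hi, by omega⟩ * wa ⟨j, by omega, hj⟩)
        (wa ⟨j + 1, by omega, h⟩ * wa ⟨i, hi, by omega⟩)
        (by simp only [relsAB, Set.mem_union]
            exact Or.inl <| Or.inl <| Or.inl <| Or.inl <| Or.inl <| Or.inl
              ⟨_, _, _, hij, rfl, rfl⟩)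
      simpa using this
  a_top := extendOne_of_notMem _ (by simp)
  b_b i j hj hji hi := by
    rw [extendOne_of_mem _ (k := i) ⟨by omega, hi⟩, extendOne_of_mem _ (k := j) ⟨hj, by omega⟩]
    rcases hj.eq_or_lt with h | h
    · rw [extendOne_of_notMem _ (by simp only [Set.mem_Ico]; omega), one_mul]
      have := hf (wb ⟨i, by omega, hi⟩ * wb ⟨j, hj, by omega⟩) (wb ⟨i, by omega, hi⟩)
        (by simp only [relsAB, Set.mem_union]
            exact Or.inl <| Or.inl <| Or.inl <| Or.inr ⟨_, _, h.symm, rfl⟩)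
      simpa using this
    · rw [extendOne_of_mem _ (k := j - 1) ⟨by omega, by omega⟩]
      have := hf (wb ⟨i, by omega, hi⟩ * wb ⟨j, hj, by omega⟩)
        (wb ⟨j - 1, by omega, by omega⟩ * wb ⟨i, by omega, hi⟩)
        (by simp only [relsAB, Set.mem_union]
            exact Or.inl <| Or.inl <| Or.inl <| Or.inl <| Or.inr
              ⟨_, _, _, hji, Nat.sub_add_cancel hj, rfl⟩)
      simpa using this
  b_zero := extendOne_of_notMem _ (by simp)
  a_b i j hj hji hi := by
    rw [extendOne_of_mem _ (k := i) ⟨by omega, hi⟩, extendOne_of_mem _ (k := j) ⟨hj, by omega⟩]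
    have := hf (wa ⟨i, by omega, hi⟩ * wb ⟨j, hj, by omega⟩)
      (wb ⟨j, hj, by omega⟩ * wa ⟨i, by omega, hi⟩)
      (by simp only [relsAB, Set.mem_union]
          exact Or.inl <| Or.inl <| Or.inr ⟨_, _, hji, rfl⟩)
    simpa using this
  a_b_last i hi hin := by
    rw [extendOne_of_mem _ (k := i) ⟨hi, hin⟩, extendOne_of_mem _ (k := n - 1) ⟨by omega, by omega⟩,
      extendOne_of_mem _ (k := i) ⟨hi, hin⟩]
    have := hf (wa ⟨i, hi, hin⟩ * wb ⟨n - 1, by omega, by omega⟩) (wb ⟨i, hi, hin⟩)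
      (by simp only [relsAB, Set.mem_union]
          exact Or.inl <| Or.inr ⟨_, _, Nat.sub_add_cancel (by omega), rfl⟩)
    simpa using this
  b_a_one i hi hin := by
    rw [extendOne_of_mem _ (k := i) ⟨hi, hin⟩, extendOne_of_mem _ (k := 1) ⟨by omega, by omega⟩,
      extendOne_of_mem _ (k := i) ⟨hi, hin⟩]
    have := hf (wb ⟨i, hi, hin⟩ * wa ⟨1, by omega, by omega⟩) (wa ⟨i, hi, hin⟩)
      (by simp only [relsAB, Set.mem_union]
          exact Or.inr ⟨_, _, rfl, rfl⟩)
    simpa using this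

lemma map_prodRev_extendOne {n : ℕ} {N : Type} [Monoid N] (φ : M →* N) (g : Idx n → M)
    (L : List ℕ) : φ (prodRev (extendOne g) L) = prodRev (extendOne fun i => φ (g i)) L := by
  induction L with
  | nil => simp
  | cons c L ih =>
    rw [prodRev_cons, map_mul, ih, prodRev_cons]
    congr 1
    simp only [extendOne]
    split_ifs <;> simp

end Presentations

/-! ### Action of the normal forms on the chain -/

lemma ordInt_ext {n : ℕ} {α β : OrdInt n}
    (h : ∀ x : Chain n, (toFn α.1 x).1 = (toFn β.1 x).1) : α = β :=
  Subtype.ext (MulOpposite.unop_injective (funext fun x => Subtype.ext (h x)))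

lemma toFn_mul_apply {n : ℕ} (α β : Transf n) (x : Chain n) :
    toFn (α * β) x = toFn β (toFn α x) := rfl

lemma toFn_evalAB_a {n : ℕ} (i : Idx n) (x : Chain n) : toFn (evalAB n (.a i)).1 x = aFn i x := rfl

lemma toFn_evalAB_b {n : ℕ} (i : Idx n) (x : Chain n) : toFn (evalAB n (.b i)).1 x = bFn i x := rfl

lemma lift_evalAB_eq {n : ℕ} (u v : FreeMonoid (GenAB n)) (h : (u, v) ∈ relsAB n) :
    FreeMonoid.lift (evalAB n) u = FreeMonoid.lift (evalAB n) v := by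
  simp only [relsAB, Set.mem_union, Set.mem_ofPred_eq, Prod.mk.injEq] at h
  rcases h with (((((⟨i, j, k, h1, h2, rfl, rfl⟩ | ⟨i, j, h1, rfl, rfl⟩) |
    ⟨i, j, k, h1, h2, rfl, rfl⟩) | ⟨i, j, h1, rfl, rfl⟩) | ⟨i, j, h1, rfl, rfl⟩) |
    ⟨i, j, h1, rfl, rfl⟩) | ⟨i, j, h1, rfl, rfl⟩ <;>
  · refine ordInt_ext fun x => ?_
    have hx := Set.mem_Icc.1 x.2
    have hi := Set.mem_Ico.1 i.2
    have hj := Set.mem_Ico.1 j.2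
    simp only [map_mul, FreeMonoid.lift_eval_of, Submonoid.coe_mul, toFn_mul_apply,
      toFn_evalAB_a, toFn_evalAB_b, aFn_val, bFn_val]
    split_ifs <;> omega

section Evaluation

variable {n : ℕ}

lemma toFn_prodRev_a {L : List ℕ} (hL : IsIndexList n L) (x : Chain n) :
    (toFn (prodRev (extendOne fun i => evalAB n (.a i)) L).1 x).1 = collapse L x.1 := by
  induction L with
  | nil => rfl
  | cons c L ih =>
    obtain ⟨hc, -, hL'⟩ := isIndexList_cons.1 hL
    rw [prodRev_cons, extendOne_of_mem _ (Set.mem_Ico.2 hc), Submonoid.coe_mul, toFn_mul_apply,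
      collapse_cons, ← ih hL']
    rfl

lemma toFn_b_last_pow (hn : 2 ≤ n) (t : ℕ) (x : Chain n) :
    (toFn ((extendOne (fun i => evalAB n (.b i)) (n - 1)) ^ t).1 x).1 = min (x.1 + t) n := by
  rw [extendOne_of_mem _ (k := n - 1) ⟨by omega, by omega⟩]
  have hx := Set.mem_Icc.1 x.2
  induction t with
  | zero =>
    change x.1 = _
    omega
  | succ t ih =>
    rw [pow_succ, Submonoid.coe_mul, toFn_mul_apply]
    change (bFn _ _).1 = _
    rw [bFn_val, ih]
    dsimp only
    split_ifs <;> omega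

lemma toFn_normalForm (hn : 2 ≤ n) {L : List ℕ} (hL : IsIndexList n L) (t : ℕ) (x : Chain n) :
    (toFn (prodRev (extendOne fun i => evalAB n (.a i)) L *
      (extendOne (fun i => evalAB n (.b i)) (n - 1)) ^ t).1 x).1 = min (collapse L x.1 + t) n := by
  rw [Submonoid.coe_mul, toFn_mul_apply, toFn_b_last_pow hn, toFn_prodRev_a hL]

/-- A larger jump would leave a gap in the image, since by monotonicity no point is sent strictly
between the images of neighbours. -/
lemma succ_le_of_mem_ordInt {α : Transf n} (hα : α ∈ OrdInt n) {x y : Chain n}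
    (hxy : y.1 = x.1 + 1) : (toFn α y).1 ≤ (toFn α x).1 + 1 := by
  by_contra! hlt
  have hy := Set.mem_Icc.1 (toFn α y).2
  obtain ⟨z, hz⟩ := hα.2.out ⟨x, rfl⟩ ⟨y, rfl⟩
    (show (⟨(toFn α x).1 + 1, by omega, by omega⟩ : Chain n) ∈ _ from
      ⟨Nat.le_succ _, hlt.le⟩)
  have hz' := congrArg Subtype.val hz
  dsimp only at hz'
  rcases le_or_gt z.1 x.1 with h | h
  · have h1 : (toFn α z).1 ≤ (toFn α x).1 := hα.1 h
    omega
  · have h1 : (toFn α y).1 ≤ (toFn α z).1 := hα.1 (show y.1 ≤ z.1 by omega)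
    omega

lemma exists_eq_normalForm (hn : 2 ≤ n) (α : OrdInt n) :
    ∃ L t, IsIndexList n L ∧
      α = prodRev (extendOne fun i => evalAB n (.a i)) L *
        (extendOne (fun i => evalAB n (.b i)) (n - 1)) ^ t := by
  classical
  -- `D` is the set of flat steps; the shift is the image of 1, minus 1. The bound `t ≤ L.length` is
  -- not needed here: the sums are values of the map, so they do not exceed `n`.
  let D : Finset ℕ := (Finset.Ico 1 n).filter fun k =>
    ∃ x y : Chain n, x.1 = k ∧ y.1 = k + 1 ∧ toFn α.1 y = toFn α.1 x
  have hD : IsIndexList n (D.sort (· ≤ ·)) := by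
    refine ⟨(Finset.sortedLT_sort D).pairwise, fun c hc => ?_⟩
    rw [Finset.mem_sort, Finset.mem_filter, Finset.mem_Ico] at hc
    exact hc.1
  let o : Chain n := ⟨1, le_rfl, by omega⟩
  have ho := Set.mem_Icc.1 (toFn α.1 o).2
  refine ⟨D.sort (· ≤ ·), (toFn α.1 o).1 - 1, hD, ordInt_ext fun x => ?_⟩
  rw [toFn_normalForm hn hD]
  have key : ∀ k (hk : k + 1 ≤ n), (toFn α.1 ⟨k + 1, by omega, hk⟩).1 =
      collapse (D.sort (· ≤ ·)) (k + 1) + ((toFn α.1 o).1 - 1) := by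
    intro k
    induction k with
    | zero =>
      intro hk
      rw [collapse_of_le fun c hc => (hD.2 c hc).1]
      change (toFn α.1 o).1 = _
      omega
    | succ k ih =>
      intro hk
      have h1 := ih (by omega)
      have h2 := succ_le_of_mem_ordInt α.2 (x := ⟨k + 1, by omega, by omega⟩)
        (y := ⟨k + 1 + 1, by omega, hk⟩) rfl
      have h3 : (toFn α.1 ⟨k + 1, by omega, by omega⟩).1 ≤
          (toFn α.1 ⟨k + 1 + 1, by omega, hk⟩).1 := α.2.1 (Nat.le_succ _)
      rw [collapse_succ hD.1]
      split_ifs with hm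
      · rw [Finset.mem_sort, Finset.mem_filter] at hm
        obtain ⟨-, ⟨x, hx⟩, ⟨y, hy⟩, rfl, rfl, hxy⟩ := hm
        rw [← h1, hxy]
      · have : (toFn α.1 ⟨k + 1 + 1, by omega, hk⟩).1 ≠
            (toFn α.1 ⟨k + 1, by omega, by omega⟩).1 := by
          intro h
          refine hm ?_
          rw [Finset.mem_sort, Finset.mem_filter, Finset.mem_Ico]
          exact ⟨⟨by omega, by omega⟩, _, _, rfl, rfl, Subtype.ext h⟩
        omega
  obtain ⟨x, hx1, hxn⟩ := x
  obtain ⟨k, rfl⟩ : ∃ k, x = k + 1 := ⟨x - 1, by omega⟩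
  have h1 := key k hxn
  have h2 := Set.mem_Icc.1 (toFn α.1 ⟨k + 1, hx1, hxn⟩).2
  dsimp only
  omega

end Evaluation

/-! ### The presentation of the order-preserving monoid -/

/-- The relations `relsAB n` present `OrdInt n`. -/
theorem definedBy_relsAB {n : ℕ} (hn : 2 ≤ n) : DefinedBy (evalAB n) (relsAB n) := by
  let r : FreeMonoid (GenAB n) → FreeMonoid (GenAB n) → Prop := fun u v => (u, v) ∈ relsAB n
  have hmap : ∀ L t, PresentedMonoid.lift (rels := r) (evalAB n) lift_evalAB_eq
      (prodRev (extendOne fun i => PresentedMonoid.of r (.a i)) L *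
        extendOne (fun i => PresentedMonoid.of r (.b i)) (n - 1) ^ t) =
      prodRev (extendOne fun i => evalAB n (.a i)) L *
        extendOne (fun i => evalAB n (.b i)) (n - 1) ^ t := by
    intro L t
    rw [map_mul, map_pow, map_prodRev_extendOne]
    have hk : n - 1 ∈ Set.Ico 1 n := ⟨by omega, by omega⟩
    rw [extendOne_of_mem _ hk, extendOne_of_mem _ hk]
    simp only [PresentedMonoid.lift_of]
  have H := satisfiesRels_extendOne (PresentedMonoid.of r) fun u v huv => by
    rw [lift_presentedMonoid_of, lift_presentedMonoid_of]
    exact PresentedMonoid.mk_eq_mk_of_rel huv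
  have hNF : ∀ x : PresentedMonoid r, ∃ L t, IsIndexList n L ∧ t ≤ L.length ∧
      x = prodRev (extendOne fun i => PresentedMonoid.of r (.a i)) L *
        extendOne (fun i => PresentedMonoid.of r (.b i)) (n - 1) ^ t := by
    intro x
    refine H.exists_normalForm hn (s := Set.range (PresentedMonoid.of r)) ?_ ?_
    · rintro _ ⟨⟨i, hi⟩ | ⟨i, hi⟩, rfl⟩
      · exact ⟨i, hi.1, hi.2, Or.inl (extendOne_of_mem (fun i => PresentedMonoid.of r (.a i)) hi).symm⟩
      · exact ⟨i, hi.1, hi.2, Or.inr (extendOne_of_mem (fun i => PresentedMonoid.of r (.b i)) hi).symm⟩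
    · rw [PresentedMonoid.closure_range_of]
      trivial
  refine definedBy_of_bijective lift_evalAB_eq ⟨fun x y hxy => ?_, fun α => ?_⟩
  · obtain ⟨L, t, hL, ht, rfl⟩ := hNF x
    obtain ⟨L', t', hL', ht', rfl⟩ := hNF y
    rw [hmap, hmap] at hxy
    obtain ⟨rfl, rfl⟩ := collapse_add_injective hn hL hL' (t := t) (t' := t') fun k hk hkn => by
      have h1 := congrArg (fun f : OrdInt n => (toFn f.1 ⟨k, hk, hkn⟩).1) hxy
      rw [toFn_normalForm hn hL, toFn_normalForm hn hL'] at h1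
      -- Collapsed values are at most `n - L.length` and `t ≤ L.length`, so the minimum with `n` is
      -- inactive on both sides.
      have h2 := collapse_monotone hL.1 hkn
      have h3 := collapse_monotone hL'.1 hkn
      have h4 := collapse_add_length hL.1 fun c hc => (hL.2 c hc).2
      have h5 := collapse_add_length hL'.1 fun c hc => (hL'.2 c hc).2
      dsimp only at h1
      omega
    rfl
  · obtain ⟨L, t, -, rfl⟩ := exists_eq_normalForm hn α
    exact ⟨_, hmap L t⟩

/-! ### Adjoining the reflection -/

section MonInt

variable {n : ℕ}

lemma monInt_ext {α β : MonInt n}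
    (h : ∀ x : Chain n, (toFn α.1 x).1 = (toFn β.1 x).1) : α = β :=
  Subtype.ext (MulOpposite.unop_injective (funext fun x => Subtype.ext (h x)))

/-- The inclusion of `OrdInt n` into `MonInt n`. -/
abbrev ordIntIncl (n : ℕ) : OrdInt n →* MonInt n := Submonoid.inclusion (ordInt_le_monInt n)

lemma ordIntIncl_injective : Function.Injective (ordIntIncl n) :=
  Submonoid.inclusion_injective (ordInt_le_monInt n)

lemma lift_evalC_liftWord (w : FreeMonoid (GenAB n)) :
    FreeMonoid.lift (evalC n) (liftWord w) = ordIntIncl n (FreeMonoid.lift (evalAB n) w) := by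
  have : (FreeMonoid.lift (evalC n)).comp (FreeMonoid.map GenC.ab) =
      (ordIntIncl n).comp (FreeMonoid.lift (evalAB n)) :=
    FreeMonoid.hom_eq fun x => by simp; rfl
  exact DFunLike.congr_fun this w

lemma toFn_a_one_pow (h1 : 1 ∈ Set.Ico 1 n) (t : ℕ) (x : Chain n) :
    (toFn ((evalAB n (.a ⟨1, h1⟩)) ^ t).1 x).1 = max 1 (x.1 - t) := by
  have hx := Set.mem_Icc.1 x.2
  induction t with
  | zero =>
    change x.1 = _
    omega
  | succ t ih =>
    rw [pow_succ, Submonoid.coe_mul, toFn_mul_apply, toFn_evalAB_a, aFn_val, ih]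
    dsimp only
    split_ifs <;> omega

lemma toFn_b_pow_of_last (hn : 2 ≤ n) (h : n - 1 ∈ Set.Ico 1 n) (t : ℕ) (x : Chain n) :
    (toFn ((evalAB n (.b ⟨n - 1, h⟩)) ^ t).1 x).1 = min (x.1 + t) n := by
  rw [← toFn_b_last_pow hn, extendOne_of_mem _ h]

lemma lift_evalC_eq (hn : 2 ≤ n) {R : Rels (GenAB n)}
    (hR : ∀ u v, (u, v) ∈ R → FreeMonoid.lift (evalAB n) u = FreeMonoid.lift (evalAB n) v)
    (u v : FreeMonoid (GenC n)) (h : (u, v) ∈ relsBar R) :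
    FreeMonoid.lift (evalC n) u = FreeMonoid.lift (evalC n) v := by
  rcases h with ((⟨⟨u, v⟩, huv, h⟩ | h) | ⟨i, j, hij, h⟩) | ⟨⟨i, hi⟩, ⟨j, hj⟩, h1, hj1, h⟩
  · obtain ⟨rfl, rfl⟩ := Prod.mk.inj h
    rw [lift_evalC_liftWord, lift_evalC_liftWord, hR u v huv]
  · obtain ⟨rfl, rfl⟩ := Prod.mk.inj h
    refine monInt_ext fun x => ?_
    have hx := Set.mem_Icc.1 x.2
    rw [map_mul, FreeMonoid.lift_eval_of, map_one]
    change (hFn (hFn x)).1 = x.1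
    rw [hFn_val, hFn_val]
    omega
  · obtain ⟨rfl, rfl⟩ := Prod.mk.inj h
    refine monInt_ext fun x => ?_
    have hx := Set.mem_Icc.1 x.2
    rw [map_mul, map_mul, FreeMonoid.lift_eval_of, lift_evalC_liftWord, lift_evalC_liftWord,
      FreeMonoid.lift_eval_of, FreeMonoid.lift_eval_of]
    change (aFn i (hFn x)).1 = (hFn (bFn j x)).1
    rw [hFn_val, aFn_val, hFn_val, bFn_val]
    split_ifs <;> omega
  · obtain ⟨rfl, rfl⟩ := Prod.mk.inj h
    dsimp only at h1 hj1
    obtain rfl : j = n - 1 := by omega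
    subst h1
    refine monInt_ext fun x => ?_
    have hx := Set.mem_Icc.1 x.2
    rw [map_mul, map_pow, map_pow, lift_evalC_liftWord, lift_evalC_liftWord,
      FreeMonoid.lift_eval_of, FreeMonoid.lift_eval_of, FreeMonoid.lift_eval_of, ← map_pow,
      ← map_pow]
    change (hFn (toFn ((evalAB n (.a ⟨1, hi⟩)) ^ (n - 1)).1 x)).1 =
      (toFn ((evalAB n (.b ⟨n - 1, hj⟩)) ^ (n - 1)).1 x).1
    rw [hFn_val, toFn_a_one_pow, toFn_b_pow_of_last hn]
    omega

/-- The first power sends everything to 1 and the second carries 1 to `c`. All constants thus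
contain $a_1^{n-1}$, the word to which $N_2$ applies. -/
lemma eq_a_pow_mul_b_pow_of_const (hn : 2 ≤ n) (h1 : 1 ∈ Set.Ico 1 n)
    (hl : n - 1 ∈ Set.Ico 1 n) {v : OrdInt n} {c : Chain n} (hv : ∀ x, toFn v.1 x = c) :
    v = evalAB n (.a ⟨1, h1⟩) ^ (n - 1) * evalAB n (.b ⟨n - 1, hl⟩) ^ (c.1 - 1) := by
  refine ordInt_ext fun x => ?_
  have hx := Set.mem_Icc.1 x.2
  have hc := Set.mem_Icc.1 c.2
  rw [Submonoid.coe_mul, toFn_mul_apply, toFn_b_pow_of_last hn, toFn_a_one_pow, hv]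
  omega

lemma exists_ordInt_or (f : MonInt n) :
    ∃ u : OrdInt n, f = ordIntIncl n u ∨ f = ordIntIncl n u * evalC n .h := by
  obtain ⟨f, hf | hf, hc⟩ := f
  · exact ⟨⟨f, hf, hc⟩, Or.inl rfl⟩
  · have hm : Monotone (toFn (f * ofFn hFn)) := by
      intro x y hxy
      rw [toFn_mul_apply, toFn_mul_apply]
      exact hFn_antitone (hf hxy)
    refine ⟨⟨f * ofFn hFn, hm, ((MonInt n).mul_mem ⟨Or.inr hf, hc⟩ (hFn_mem n)).2⟩,
      Or.inr (monInt_ext fun x => ?_)⟩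
    change (toFn f x).1 = (hFn (hFn (toFn f x))).1
    have h := Set.mem_Icc.1 (toFn f x).2
    rw [hFn_val, hFn_val]
    omega

/-- An order-preserving map whose reflection is order-preserving is constant. -/
lemma exists_const_of_incl_eq (hn : 2 ≤ n) {u v : OrdInt n}
    (h : ordIntIncl n u = ordIntIncl n v * evalC n .h) : ∃ c, ∀ x, toFn v.1 x = c := by
  have huv : ∀ x, (toFn u.1 x).1 = n + 1 - (toFn v.1 x).1 := fun x =>
    congrArg (fun f : MonInt n => (toFn f.1 x).1) h
  let o : Chain n := ⟨1, le_rfl, by omega⟩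
  refine ⟨toFn v.1 o, fun x => Subtype.ext ?_⟩
  have hx : o ≤ x := x.2.1
  have h1 : (toFn v.1 o).1 ≤ (toFn v.1 x).1 := v.2.1 hx
  have h2 : (toFn u.1 o).1 ≤ (toFn u.1 x).1 := u.2.1 hx
  have h3 := Set.mem_Icc.1 (toFn v.1 o).2
  have h4 := Set.mem_Icc.1 (toFn v.1 x).2
  rw [huv, huv] at h2
  omega

/-- Adding the relations `N0`, `N1`, `N2` to a presentation of `OrdInt n` on `A ∪ B` gives a
presentation of `MonInt n`. -/
theorem definedBy_relsBar (hn : 2 ≤ n) {R : Rels (GenAB n)} (hR : DefinedBy (evalAB n) R) :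
    DefinedBy (evalC n) (relsBar R) := by
  obtain ⟨e, he⟩ := hR
  let r : FreeMonoid (GenAB n) → FreeMonoid (GenAB n) → Prop := fun u v => (u, v) ∈ R
  let s : FreeMonoid (GenC n) → FreeMonoid (GenC n) → Prop := fun u v => (u, v) ∈ relsBar R
  have he' : ∀ w, e (PresentedMonoid.mk r w) = FreeMonoid.lift (evalAB n) w := by
    have : (e : PresentedMonoid r →* OrdInt n).comp (PresentedMonoid.mk r) =
        FreeMonoid.lift (evalAB n) := FreeMonoid.hom_eq fun x => by
      rw [FreeMonoid.lift_eval_of]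
      exact he x
    exact DFunLike.congr_fun this
  have hC := lift_evalC_eq hn (R := R) fun u v huv => by
    rw [← he', ← he', PresentedMonoid.mk_eq_mk_of_rel (rels := r) huv]
  let φ : PresentedMonoid s →* MonInt n := PresentedMonoid.lift (evalC n) hC
  have hmk : ∀ u v, (u, v) ∈ relsBar R → PresentedMonoid.mk s u = PresentedMonoid.mk s v :=
    fun u v huv => PresentedMonoid.mk_eq_mk_of_rel huv
  have hlift : ∀ w, FreeMonoid.lift (fun x => PresentedMonoid.of s (.ab x)) w =
      PresentedMonoid.mk s (liftWord w) := by
    have : FreeMonoid.lift (fun x => PresentedMonoid.of s (.ab x)) =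
        (PresentedMonoid.mk s).comp (FreeMonoid.map GenC.ab) := FreeMonoid.hom_eq fun x => by
      rw [FreeMonoid.lift_eval_of]
      rfl
    exact DFunLike.congr_fun this
  let ι₀ : PresentedMonoid r →* PresentedMonoid s :=
    PresentedMonoid.lift (fun x => PresentedMonoid.of s (.ab x)) fun u v huv => by
      rw [hlift, hlift]
      exact hmk _ _ (Or.inl (Or.inl (Or.inl ⟨(u, v), huv, rfl⟩)))
  let ι : OrdInt n →* PresentedMonoid s := ι₀.comp (e.symm : OrdInt n →* PresentedMonoid r)
  have hι : ∀ x, ι (evalAB n x) = PresentedMonoid.of s (.ab x) := by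
    intro x
    change ι₀ (e.symm (evalAB n x)) = _
    rw [← he, e.symm_apply_apply]
    rfl
  -- This makes `φ` injective on the image of `ι`, whatever the relations in `R` are.
  have hφι : ∀ u, φ (ι u) = ordIntIncl n u := by
    have : (φ.comp ι).comp (e : PresentedMonoid r →* OrdInt n) =
        (ordIntIncl n).comp (e : PresentedMonoid r →* OrdInt n) := by
      refine PresentedMonoid.ext r fun x => ?_
      change φ (ι (e _)) = ordIntIncl n (e _)
      rw [he, hι]
      rfl
    intro u
    obtain ⟨x, rfl⟩ := e.surjective u
    exact DFunLike.congr_fun this x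
  set H := PresentedMonoid.of s .h with hH
  have hφH : φ H = evalC n .h := rfl
  have hHH : H * H = 1 := hmk _ _ (Or.inl (Or.inl (Or.inr rfl)))
  have hHa : ∀ i j : Idx n, i.1 + j.1 = n → H * ι (evalAB n (.a i)) = ι (evalAB n (.b j)) * H := by
    intro i j hij
    rw [hι, hι]
    exact hmk _ _ (Or.inl (Or.inr ⟨i, j, hij, rfl⟩))
  have hHb : ∀ i j : Idx n, i.1 + j.1 = n → H * ι (evalAB n (.b j)) = ι (evalAB n (.a i)) * H := by
    intro i j hij
    calc H * ι (evalAB n (.b j)) = H * (ι (evalAB n (.b j)) * H) * H := by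
          rw [mul_assoc, mul_assoc, hHH, mul_one]
      _ = ι (evalAB n (.a i)) * H := by rw [← hHa i j hij, ← mul_assoc H H, hHH, one_mul]
  have h1 : 1 ∈ Set.Ico 1 n := ⟨le_rfl, by omega⟩
  have hl : n - 1 ∈ Set.Ico 1 n := ⟨by omega, by omega⟩
  have hN2 : ι (evalAB n (.a ⟨1, h1⟩)) ^ (n - 1) * H = ι (evalAB n (.b ⟨n - 1, hl⟩)) ^ (n - 1) := by
    rw [hι, hι]
    have := hmk _ _ (Or.inr ⟨⟨1, h1⟩, ⟨n - 1, hl⟩, rfl, Nat.sub_add_cancel (by omega), rfl⟩)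
    rwa [map_mul, map_pow, map_pow] at this
  have hconst : ∀ (v : OrdInt n) (c : Chain n), (∀ x, toFn v.1 x = c) → ∃ w, ι v * H = ι w := by
    intro v c hv
    have hsc : SemiconjBy H (ι (evalAB n (.a ⟨1, h1⟩))) (ι (evalAB n (.b ⟨n - 1, hl⟩))) :=
      hHa _ _ (by dsimp only; omega)
    -- $a_1^{n-1}b_{n-1}^{c-1}h=a_1^{n-1}h\,a_1^{c-1}=b_{n-1}^{n-1}a_1^{c-1}$, by $N_1$ and then
    -- $N_2$.
    refine ⟨evalAB n (.b ⟨n - 1, hl⟩) ^ (n - 1) * evalAB n (.a ⟨1, h1⟩) ^ (c.1 - 1), ?_⟩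
    rw [eq_a_pow_mul_b_pow_of_const hn h1 hl hv, map_mul, map_mul, map_pow, map_pow, map_pow,
      map_pow, mul_assoc, ← (hsc.pow_right _).eq, ← mul_assoc, hN2]
  have hform : ∀ x : PresentedMonoid s, ∃ u, x = ι u ∨ x = ι u * H := by
    intro x
    have hx : x ∈ Submonoid.closure (Set.range (PresentedMonoid.of s)) := by
      rw [PresentedMonoid.closure_range_of]
      trivial
    induction hx using Submonoid.closure_induction_right with
    | one => exact ⟨1, Or.inl (map_one ι).symm⟩
    | mul_right x _ y hy ih =>
      obtain ⟨u, hu⟩ := ih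
      have hrefl : ∀ i : Idx n, ∃ j : Idx n, i.1 + j.1 = n := fun i =>
        ⟨⟨n - i.1, by have := i.2.1; have := i.2.2; constructor <;> omega⟩,
          Nat.add_sub_of_le i.2.2.le⟩
      obtain ⟨g | _, rfl⟩ := hy
      · rw [← hι]
        rcases hu with rfl | rfl
        · exact ⟨u * evalAB n g, Or.inl (map_mul ι _ _).symm⟩
        · rcases g with i | i <;> obtain ⟨j, hij⟩ := hrefl i
          · refine ⟨u * evalAB n (.b j), Or.inr ?_⟩
            rw [mul_assoc, hHa i j hij, map_mul, mul_assoc]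
          · refine ⟨u * evalAB n (.a j), Or.inr ?_⟩
            rw [mul_assoc, hHb j i (by omega), map_mul, mul_assoc]
      · rcases hu with rfl | rfl
        · exact ⟨u, Or.inr rfl⟩
        · exact ⟨u, Or.inl (by rw [mul_assoc, ← hH, hHH, mul_one])⟩
  -- Equal values force `v` to be constant; `hconst` then absorbs `H`, and the comparison takes
  -- place within the image of `ι`.
  have hmixed : ∀ u v, φ (ι u) = φ (ι v * H) → ι u = ι v * H := by
    intro u v huv
    have huv' := huv
    rw [map_mul, hφι, hφι, hφH] at huv'
    obtain ⟨c, hc⟩ := exists_const_of_incl_eq hn huv'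
    obtain ⟨w, hw⟩ := hconst v c hc
    rw [hw, hφι, hφι] at huv
    rw [hw, ordIntIncl_injective huv]
  refine definedBy_of_bijective hC ⟨fun x y hxy => ?_, fun f => ?_⟩
  · change φ x = φ y at hxy
    obtain ⟨u, rfl | rfl⟩ := hform x <;> obtain ⟨v, rfl | rfl⟩ := hform y
    · rw [hφι, hφι] at hxy
      rw [ordIntIncl_injective hxy]
    · exact hmixed u v hxy
    · exact (hmixed v u hxy.symm).symm
    · have h := congrArg (· * φ H) hxy
      simp only [← map_mul, mul_assoc, hHH, mul_one] at h
      rw [hφι, hφι] at h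
      rw [ordIntIncl_injective h]
  · change ∃ x, φ x = f
    obtain ⟨u, rfl | rfl⟩ := exists_ordInt_or f
    · exact ⟨ι u, hφι u⟩
    · exact ⟨ι u * H, by rw [map_mul, hφι, hφH]⟩

end MonInt

/-! ### Counting letters and relations -/

section Counting

variable {n : ℕ}

lemma card_idx (n : ℕ) : Nat.card (Idx n) = n - 1 := by
  rw [Nat.card_eq_fintype_card]
  simp

/-- The two families of letters and `h`, as a disjoint sum. -/
def genCEquiv (n : ℕ) : GenC n ≃ (Idx n ⊕ Idx n) ⊕ Unit where
  toFun
    | .ab (.a i) => .inl (.inl i)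
    | .ab (.b i) => .inl (.inr i)
    | .h => .inr ()
  invFun
    | .inl (.inl i) => .ab (.a i)
    | .inl (.inr i) => .ab (.b i)
    | .inr () => .h
  left_inv := by rintro ((i | i) | _) <;> rfl
  right_inv := by rintro ((i | i) | _) <;> rfl

lemma card_genC (hn : 2 ≤ n) : Nat.card (GenC n) = 2 * n - 1 := by
  rw [Nat.card_congr (genCEquiv n), Nat.card_sum, Nat.card_sum, card_idx, Nat.card_unique]
  omega

/-- The images of 1 and `n` separate the kinds of letter: $(1,n-1)$ for $a_i$, $(2,n)$ for $b_i$,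
$(n,1)$ for $h$. Within a kind, the point where the step occurs gives the index. -/
lemma evalC_injective (hn : 2 ≤ n) : Function.Injective (evalC n) := by
  intro x y hxy
  have hval : ∀ k (hk : k ∈ Set.Icc 1 n),
      (toFn (evalC n x).1 ⟨k, hk⟩).1 = (toFn (evalC n y).1 ⟨k, hk⟩).1 := by
    intro k hk
    rw [hxy]
  have ha : ∀ i (z : Chain n), (toFn (evalC n (.ab (.a i))).1 z).1 =
    if z.1 ≤ i.1 then z.1 else z.1 - 1 := fun _ _ => rfl
  have hb : ∀ i (z : Chain n), (toFn (evalC n (.ab (.b i))).1 z).1 =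
    if z.1 ≤ i.1 then z.1 + 1 else z.1 := fun _ _ => rfl
  have hh : ∀ z : Chain n, (toFn (evalC n .h).1 z).1 = n + 1 - z.1 := fun _ => rfl
  have hfirst := hval 1 ⟨le_rfl, by omega⟩
  have hlast := hval n ⟨by omega, le_rfl⟩
  have hidx : ∀ i : Idx n, 1 ≤ i.1 ∧ i.1 < n := fun i => i.2
  rcases x with (i | i) | _ <;> rcases y with (j | j) | _ <;>
    simp only [ha, hb, hh] at hval hfirst hlast
  · have hi := hidx i
    have hj := hidx j
    have h1 := hval (i.1 + 1) ⟨by omega, by omega⟩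
    have h2 := hval (j.1 + 1) ⟨by omega, by omega⟩
    obtain rfl : i = j := Subtype.ext (by split_ifs at h1 h2 <;> omega)
    rfl
  · have hi := hidx i
    have hj := hidx j
    split_ifs at hfirst hlast <;> omega
  · have hi := hidx i
    split_ifs at hfirst hlast <;> omega
  · have hi := hidx i
    have hj := hidx j
    split_ifs at hfirst hlast <;> omega
  · have hi := hidx i
    have hj := hidx j
    have h1 := hval i.1 ⟨by omega, by omega⟩
    have h2 := hval j.1 ⟨by omega, by omega⟩
    obtain rfl : i = j := Subtype.ext (by split_ifs at h1 h2 <;> omega)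
    rfl
  · have hi := hidx i
    split_ifs at hfirst hlast <;> omega
  · have hj := hidx j
    split_ifs at hfirst hlast <;> omega
  · have hj := hidx j
    split_ifs at hfirst hlast <;> omega
  · rfl

lemma liftWord_injective : Function.Injective (liftWord (n := n)) := by
  intro u v h
  exact List.map_injective_iff.2 (fun x y hxy => GenC.ab.inj hxy) h

lemma h_notMem_liftWord (w : FreeMonoid (GenAB n)) : GenC.h ∉ (liftWord w).toList := by
  rw [FreeMonoid.toList_map]
  simp

lemma encard_N1 (n : ℕ) : (N1 n).encard = (n - 1 : ℕ) := by
  let f : Idx n → FreeMonoid (GenC n) × FreeMonoid (GenC n) := fun i =>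
    (wh n * liftWord (wa i), liftWord (wb ⟨n - i.1, by
      have := i.2.1; have := i.2.2; constructor <;> omega⟩) * wh n)
  have hf : Function.Injective f := fun i j hij => by
    have h := congrArg (fun p => p.1.toList) hij
    simpa [f] using h
  have hr : N1 n = Set.range f := by
    ext p
    constructor
    · rintro ⟨i, ⟨j, hj⟩, hij, rfl⟩
      dsimp only at hij
      obtain rfl : j = n - i.1 := by omega
      exact ⟨i, rfl⟩
    · rintro ⟨i, rfl⟩
      exact ⟨i, _, Nat.add_sub_of_le i.2.2.le, rfl⟩
  rw [hr, ← Set.image_univ, hf.encard_image, Set.encard_univ, ENat.card_eq_coe_natCard, card_idx]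

lemma N2_eq_singleton (hn : 2 ≤ n) : N2 n =
    {(liftWord (wa ⟨1, le_rfl, by omega⟩) ^ (n - 1) * wh n,
      liftWord (wb ⟨n - 1, by omega, by omega⟩) ^ (n - 1))} := by
  ext p
  constructor
  · rintro ⟨⟨i, hi⟩, ⟨j, hj⟩, h1, h2, rfl⟩
    dsimp only at h1 h2
    obtain rfl : j = n - 1 := by omega
    subst h1
    rfl
  · rintro rfl
    exact ⟨_, _, rfl, Nat.sub_add_cancel (by omega), rfl⟩

/-- Left-hand sides tell the four sets apart: no $h$ in $R$, $hh$ in $N_0$, $ha_i$ in $N_1$, and in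
$N_2$ a first letter from $A$ with $h$ further on. The extra relations number $1+(n-1)+1$. Since `R`
may be infinite, the count is extended. -/
lemma encard_relsBar (hn : 2 ≤ n) (R : Rels (GenAB n)) :
    (relsBar R).encard = R.encard + (n + 1) := by
  have h0 : ∀ p ∈ N0 n, p.1.toList = [GenC.h, GenC.h] := by
    rintro p rfl
    rfl
  have h1 : ∀ p ∈ N1 n, ∃ i, p.1.toList = [GenC.h, GenC.ab (.a i)] := by
    rintro p ⟨i, j, -, rfl⟩
    exact ⟨i, rfl⟩
  have h2 : ∀ p ∈ N2 n, ∃ i l, p.1.toList = GenC.ab i :: l ∧ GenC.h ∈ l := by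
    rintro p ⟨i, j, -, -, rfl⟩
    obtain ⟨m, hm⟩ : ∃ m, n - 1 = m + 1 := ⟨n - 2, by omega⟩
    refine ⟨.a i, (liftWord (wa i) ^ m * wh n).toList, ?_, ?_⟩
    · rw [hm, pow_succ', mul_assoc]
      rfl
    · simp
  have hR : ∀ p ∈ Prod.map liftWord liftWord '' R, GenC.h ∉ p.1.toList := by
    rintro p ⟨q, -, rfl⟩
    exact h_notMem_liftWord q.1
  have d0 : Disjoint (Prod.map liftWord liftWord '' R) (N0 n) := by
    refine Set.disjoint_left.2 fun p hp hp' => hR p hp ?_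
    rw [h0 p hp']
    simp
  have d1 : Disjoint (Prod.map liftWord liftWord '' R ∪ N0 n) (N1 n) := by
    refine Set.disjoint_left.2 fun p hp hp' => ?_
    obtain ⟨i, hi⟩ := h1 p hp'
    rcases hp with hp | hp
    · refine hR p hp ?_
      rw [hi]
      simp
    · simp [h0 p hp] at hi
  have d2 : Disjoint (Prod.map liftWord liftWord '' R ∪ N0 n ∪ N1 n) (N2 n) := by
    refine Set.disjoint_left.2 fun p hp hp' => ?_
    obtain ⟨i, l, hi, hl⟩ := h2 p hp'
    rcases hp with (hp | hp) | hp
    · refine hR p hp ?_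
      rw [hi]
      simp [hl]
    · simp [h0 p hp] at hi
    · obtain ⟨j, hj⟩ := h1 p hp
      simp [hj] at hi
  rw [relsBar, Set.encard_union_eq d2, Set.encard_union_eq d1, Set.encard_union_eq d0,
    (liftWord_injective.prodMap liftWord_injective).encard_image, encard_N1 n,
    N2_eq_singleton hn, N0, Set.encard_singleton, Set.encard_singleton, add_assoc, add_assoc]
  congr 1
  norm_cast
  omega

/-- The pairs `j < i < n - 1`. -/
abbrev Pairs (n : ℕ) : Type := Σ i : Fin (n - 1), Fin i.1

lemma card_pairs (n : ℕ) : Nat.card (Pairs n) * 2 = (n - 1) * (n - 2) := by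
  rw [Nat.card_sigma]
  simp only [Nat.card_eq_fintype_card, Fintype.card_fin]
  rw [Fin.sum_univ_eq_sum_range (fun i => i) (n - 1), Finset.sum_range_id_mul_two]
  rfl

/-- The index `k + 1`. -/
abbrev succIdx (k : ℕ) (h : k + 1 < n) : Idx n := ⟨k + 1, Nat.succ_le_succ (Nat.zero_le k), h⟩

/-- An enumeration of `relsAB n`. -/
def enumRels (hn : 2 ≤ n) : (((((Pairs n ⊕ Fin (n - 1)) ⊕ Pairs n) ⊕ Fin (n - 1)) ⊕ Pairs n) ⊕
    Fin (n - 1)) ⊕ Fin (n - 1) → FreeMonoid (GenAB n) × FreeMonoid (GenAB n) :=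
  Sum.elim (Sum.elim (Sum.elim (Sum.elim (Sum.elim (Sum.elim
    -- The shifts encode weak inequalities by strict pairs: here $i$ is `q.2.1 + 1` and $j$ is
    -- `q.1.1`, so $i\le j\le n-2$. In the family $b_ib_j$, $i$ is `q.1.1 + 1` and $j$ is `q.2.1 +
    -- 2`.
    (fun q => (wa (succIdx q.2.1 (by omega)) * wa ⟨q.1.1, Nat.zero_lt_of_lt q.2.2, by omega⟩,
      wa (succIdx q.1.1 (by omega)) * wa (succIdx q.2.1 (by omega))))
    (fun i => (wa (succIdx i.1 (by omega)) * wa ⟨n - 1, by omega, by omega⟩,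
      wa (succIdx i.1 (by omega)))))
    (fun q => (wb (succIdx q.1.1 (by omega)) * wb (succIdx (q.2.1 + 1) (by omega)),
      wb (succIdx q.2.1 (by omega)) * wb (succIdx q.1.1 (by omega)))))
    (fun i => (wb (succIdx i.1 (by omega)) * wb ⟨1, by omega, by omega⟩,
      wb (succIdx i.1 (by omega)))))
    (fun q => (wa (succIdx q.1.1 (by omega)) * wb (succIdx q.2.1 (by omega)),
      wb (succIdx q.2.1 (by omega)) * wa (succIdx q.1.1 (by omega)))))
    (fun i => (wa (succIdx i.1 (by omega)) * wb ⟨n - 1, by omega, by omega⟩,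
      wb (succIdx i.1 (by omega)))))
    (fun i => (wb (succIdx i.1 (by omega)) * wa ⟨1, by omega, by omega⟩,
      wa (succIdx i.1 (by omega))))

lemma enumRels_injective (hn : 2 ≤ n) : Function.Injective (enumRels hn) := by
  intro p q h
  -- The left-hand words are already pairwise distinct, so the right-hand sides can be dropped.
  replace h := congrArg (fun z => z.1.toList) h
  rcases p with (((((⟨⟨i, hi⟩, ⟨j, hj⟩⟩ | ⟨i, hi⟩) | ⟨⟨i, hi⟩, ⟨j, hj⟩⟩) | ⟨i, hi⟩) |
      ⟨⟨i, hi⟩, ⟨j, hj⟩⟩) | ⟨i, hi⟩) | ⟨i, hi⟩ <;>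
    rcases q with (((((⟨⟨k, hk⟩, ⟨l, hl⟩⟩ | ⟨k, hk⟩) | ⟨⟨k, hk⟩, ⟨l, hl⟩⟩) | ⟨k, hk⟩) |
      ⟨⟨k, hk⟩, ⟨l, hl⟩⟩) | ⟨k, hk⟩) | ⟨k, hk⟩ <;>
    simp [enumRels, Subtype.ext_iff] at h <;>
    first
    | (exfalso; dsimp only at *; omega)
    | (obtain ⟨rfl, rfl⟩ := h; rfl)

lemma range_enumRels (hn : 2 ≤ n) : Set.range (enumRels hn) = relsAB n := by
  have hidx : ∀ i : Idx n, ∃ k : Fin (n - 1), i = succIdx k.1 (by omega) := fun i => by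
    have h1 := i.2.1
    have h2 := i.2.2
    exact ⟨⟨i.1 - 1, by omega⟩, Subtype.ext (Nat.sub_add_cancel h1).symm⟩
  simp only [enumRels, Set.Sum.elim_range, relsAB]
  refine congrArg₂ _ (congrArg₂ _ (congrArg₂ _ (congrArg₂ _ (congrArg₂ _ (congrArg₂ _
    ?_ ?_) ?_) ?_) ?_) ?_) ?_ <;> ext p <;> constructor
  · rintro ⟨⟨⟨i, hi⟩, ⟨j, hj⟩⟩, rfl⟩
    refine ⟨_, _, _, ?_, ?_, rfl⟩
    · exact hj
    · rfl
  · rintro ⟨⟨i, hi⟩, ⟨j, hj⟩, ⟨k, hk⟩, h1, h2, rfl⟩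
    dsimp only at h1 h2
    subst h2
    obtain ⟨i, rfl⟩ : ∃ i', i = i' + 1 := ⟨i - 1, by have := hi.1; omega⟩
    exact ⟨⟨⟨j, by have := hk.2; omega⟩, ⟨i, h1⟩⟩, rfl⟩
  · rintro ⟨i, rfl⟩
    exact ⟨_, _, Nat.sub_add_cancel (by omega), rfl⟩
  · rintro ⟨i, ⟨j, hj⟩, h1, rfl⟩
    dsimp only at h1
    obtain rfl : j = n - 1 := by omega
    obtain ⟨i, rfl⟩ := hidx i
    exact ⟨i, rfl⟩
  · rintro ⟨⟨⟨i, hi⟩, ⟨j, hj⟩⟩, rfl⟩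
    exact ⟨_, _, _, Nat.succ_le_succ hj, rfl, rfl⟩
  · rintro ⟨⟨i, hi⟩, ⟨j, hj⟩, ⟨k, hk⟩, h1, h2, rfl⟩
    dsimp only at h1 h2
    subst h2
    obtain ⟨i, rfl⟩ : ∃ i', i = i' + 1 := ⟨i - 1, by have := hi.1; omega⟩
    obtain ⟨k, rfl⟩ : ∃ k', k = k' + 1 := ⟨k - 1, by have := hk.1; omega⟩
    exact ⟨⟨⟨i, by have := hi.2; omega⟩, ⟨k, by dsimp only; omega⟩⟩, rfl⟩
  · rintro ⟨i, rfl⟩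
    exact ⟨_, _, rfl, rfl⟩
  · rintro ⟨i, ⟨j, hj⟩, h1, rfl⟩
    dsimp only at h1
    subst h1
    obtain ⟨i, rfl⟩ := hidx i
    exact ⟨i, rfl⟩
  · rintro ⟨⟨⟨i, hi⟩, ⟨j, hj⟩⟩, rfl⟩
    exact ⟨_, _, Nat.succ_lt_succ hj, rfl⟩
  · rintro ⟨i, j, h1, rfl⟩
    obtain ⟨i, rfl⟩ := hidx i
    obtain ⟨j, rfl⟩ := hidx j
    exact ⟨⟨i, ⟨j.1, Nat.lt_of_succ_lt_succ h1⟩⟩, rfl⟩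
  · rintro ⟨i, rfl⟩
    exact ⟨_, _, Nat.sub_add_cancel (by omega), rfl⟩
  · rintro ⟨i, ⟨j, hj⟩, h1, rfl⟩
    dsimp only at h1
    obtain rfl : j = n - 1 := by omega
    obtain ⟨i, rfl⟩ := hidx i
    exact ⟨i, rfl⟩
  · rintro ⟨i, rfl⟩
    exact ⟨_, _, rfl, rfl⟩
  · rintro ⟨i, ⟨j, hj⟩, h1, rfl⟩
    dsimp only at h1
    subst h1
    obtain ⟨i, rfl⟩ := hidx i
    exact ⟨i, rfl⟩

lemma encard_relsAB (hn : 2 ≤ n) :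
    (relsAB n).encard = (3 * Nat.card (Pairs n) + 4 * (n - 1) : ℕ) := by
  rw [← range_enumRels hn, ← Set.image_univ, (enumRels_injective hn).encard_image, Set.encard_univ,
    ENat.card_eq_coe_natCard]
  simp only [Nat.card_sum, Nat.card_fin]
  congr 1
  ring

lemma two_mul_ncard_relsBar (hn : 2 ≤ n) :
    2 * (relsBar (relsAB n)).ncard = 3 * n ^ 2 + n := by
  have h : (relsBar (relsAB n)).encard =
      (3 * Nat.card (Pairs n) + 4 * (n - 1) + (n + 1) : ℕ) := by
    rw [encard_relsBar hn, encard_relsAB hn]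
    norm_cast
  rw [Set.ncard, h, ENat.toNat_natCast]
  have hp := card_pairs n
  obtain ⟨m, rfl⟩ : ∃ m, n = m + 2 := ⟨n - 2, by omega⟩
  simp only [Nat.add_sub_cancel, show m + 2 - 1 = m + 1 from rfl] at hp ⊢
  nlinarith

end Counting

end IntervalMonoids

open IntervalMonoids in
theorem theorem8 (n : ℕ) (hn : 2 ≤ n) :
    -- the alphabet `C` has `2n - 1` letters, which name distinct elements of `MonInt n`
    Nat.card (GenC n) = 2 * n - 1 ∧ Function.Injective (evalC n) ∧
    -- the explicit relations `R` present `OrdInt n`, and with `N₀`, `N₁`, `N₂` they present `MonInt n`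
    DefinedBy (evalAB n) (relsAB n) ∧
    DefinedBy (evalC n) (relsBar (relsAB n)) ∧
    2 * (relsBar (relsAB n)).ncard = 3 * n ^ 2 + n ∧
    -- the same extension works for every presentation of `OrdInt n` on `A ∪ B`
    (∀ R : Rels (GenAB n), DefinedBy (evalAB n) R →
      DefinedBy (evalC n) (relsBar R) ∧ (relsBar R).encard = R.encard + (n + 1)) :=
  ⟨card_genC hn, evalC_injective hn, definedBy_relsAB hn,
    definedBy_relsBar hn (definedBy_relsAB hn), two_mul_ncard_relsBar hn,
    fun R hR => ⟨definedBy_relsBar hn hR, encard_relsBar hn R⟩⟩
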